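/- Let $X$ be a Hausdorff topological vector space over $\mathbb C$ (not assumed locally convex) and let $K\colon X\to X$ be a compact linear operator, i.e. $K$ maps some zero neighbourhood into a set with compact closure. Then $$r(K)\le|\sigma(K)|,\qquad |\sigma(K)|=\sup\{|\lambda| : \lambda\in\sigma(K)\},$$ for each of the following spectral radii $r$ and each of the following spectra $\sigma$ (so 16 inequalities in all). Radii lie in $[0,\infty]$, with $\inf\emptyset=\infty$ and $\sup\emptyset=0$. A linear operator $T\colon X\to X$ is bb-bounded if it maps bounded sets to bounded sets, nb-bounded if it maps some zero neighbourhood to a bounded set, and nn-bounded if there is a base $\mathcal N_0$ of zero neighbourhoods such that for every $U\in\mathcal N_0$ there is $\alpha>0$ with $T(U)\subseteq\alpha U$. Here and below, bases of zero neighbourhoods consist of balanced sets and are closed under multiplication by nonzero scalars. Spectra: $\sigma^{bb}(T)$, $\sigma^{c}(T)$, $\sigma^{nn}(T)$, $\sigma^{nb}(T)$ are the sets of those $\lambda\in\mathbb C$ for which $\lambda I-T$ has no two-sided linear inverse that is, respectively, bb-bounded; continuous; nn-bounded; of the form $\alpha I+S$ with $\alpha\in\mathbb C$ and $S$ nb-bounded.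 Radii: $r_{bb}(T)$, $r_{c}(T)$, $r_{nn}(T)$, $r_{nb}(T)$ are the infima of those $\nu>0$ for which the operators $S_n=T^n/\nu^n$ tend to zero, respectively, in the following sense: - uniformly on every bounded set; - equicontinuously: for every zero neighbourhood $V$ there is a zero neighbourhood $U$ such that for every $\varepsilon>0$ one has $S_n(U)\subseteq\varepsilon V$ for all large $n$; - for some base $\mathcal N_0$ of zero neighbourhoods, for every $U\in\mathcal N_0$ and every $\varepsilon>0$ one has $S_n(U)\subseteq\varepsilon U$ for all large $n$; - uniformly on some zero neighbourhood. -/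

import Mathlib

open scoped Topology Pointwise ENNReal

namespace TVSOperator

/-- The four classes of operators: bb-bounded (bounded sets go to bounded sets), continuous,
nn-bounded, and nb-bounded (some zero neighbourhood goes to a bounded set). -/
inductive OpClass where
  | bb
  | c
  | nn
  | nb

section

variable {X : Type*} [AddCommGroup X] [Module ℂ X] [TopologicalSpace X]

/-- A base `N` of zero neighbourhoods consisting of balanced sets and closed under multiplication
by nonzero scalars. -/
structure IsZeroBase (N : Set (Set X)) : Prop where
  mem_nhds : ∀ V ∈ N, V ∈ 𝓝 (0 : X)
  exists_subset : ∀ W ∈ 𝓝 (0 : X), ∃ V ∈ N, V ⊆ W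
  balanced : ∀ V ∈ N, Balanced ℂ V
  inter : ∀ V₁ ∈ N, ∀ V₂ ∈ N, ∃ V ∈ N, V ⊆ V₁ ∩ V₂
  add : ∀ V ∈ N, ∃ U ∈ N, U + U ⊆ V
  smul : ∀ V ∈ N, ∀ a : ℂ, a ≠ 0 → a • V ∈ N

/-- `T` maps every bounded set to a bounded set. -/
def IsBBBounded (T : X →ₗ[ℂ] X) : Prop :=
  ∀ A : Set X, Bornology.IsVonNBounded ℂ A → Bornology.IsVonNBounded ℂ (T '' A)

/-- There is a base of zero neighbourhoods each member of which is mapped by `T` into a positive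
multiple of itself. -/
def IsNNBounded (T : X →ₗ[ℂ] X) : Prop :=
  ∃ N : Set (Set X), IsZeroBase N ∧ ∀ U ∈ N, ∃ a : ℝ, 0 < a ∧ T '' U ⊆ (a : ℂ) • U

/-- `T` maps some zero neighbourhood to a bounded set. -/
def IsNBBounded (T : X →ₗ[ℂ] X) : Prop :=
  ∃ U ∈ 𝓝 (0 : X), Bornology.IsVonNBounded ℂ (T '' U)

/-- The operators that are allowed as resolvents in the class `i`: the operators of the class
itself, except that for nb-bounded operators the unitalization of the algebra is used, that is,
the operators `a • 1 + S` with `a` a scalar and `S` nb-bounded. -/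
def IsAdmissibleInverse : OpClass → (X →ₗ[ℂ] X) → Prop
  | .bb, R => IsBBBounded R
  | .c, R => Continuous R
  | .nn, R => IsNNBounded R
  | .nb, R => ∃ (a : ℂ) (S : X →ₗ[ℂ] X), IsNBBounded S ∧ R = a • LinearMap.id + S

/-- The resolvent set `ρⁱ(T)`: all `z` for which `z I - T` has a two-sided inverse that is
admissible for the class `i`. -/
def resolventSet (i : OpClass) (T : X →ₗ[ℂ] X) : Set ℂ :=
  {z | ∃ R : X →ₗ[ℂ] X,
    R ∘ₗ (z • LinearMap.id - T) = LinearMap.id ∧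
    (z • LinearMap.id - T) ∘ₗ R = LinearMap.id ∧
    IsAdmissibleInverse i R}

/-- The spectrum `σⁱ(T)`, the complement of `ρⁱ(T)`. -/
def spectrum (i : OpClass) (T : X →ₗ[ℂ] X) : Set ℂ :=
  (resolventSet i T)ᶜ

/-- The sequence `S` tends to zero uniformly on `A`. -/
def TendsToZeroUniformlyOn (S : ℕ → X →ₗ[ℂ] X) (A : Set X) : Prop :=
  ∀ V ∈ 𝓝 (0 : X), ∃ n₀ : ℕ, ∀ n > n₀, S n '' A ⊆ V

/-- Convergence to zero of a sequence of operators in the sense of each class: uniformly on every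
bounded set; equicontinuously; in the sense of nn-convergence; uniformly on some zero
neighbourhood. -/
def TendsToZero : OpClass → (ℕ → X →ₗ[ℂ] X) → Prop
  | .bb, S => ∀ A : Set X, Bornology.IsVonNBounded ℂ A → TendsToZeroUniformlyOn S A
  | .c, S => ∀ V ∈ 𝓝 (0 : X), ∃ U ∈ 𝓝 (0 : X), ∀ ε : ℝ, 0 < ε →
      ∃ n₀ : ℕ, ∀ n > n₀, S n '' U ⊆ (ε : ℂ) • V
  | .nn, S => ∃ N : Set (Set X), IsZeroBase N ∧ ∀ U ∈ N, ∀ ε : ℝ, 0 < ε →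
      ∃ n₀ : ℕ, ∀ n > n₀, S n '' U ⊆ (ε : ℂ) • U
  | .nb, S => ∃ U ∈ 𝓝 (0 : X), TendsToZeroUniformlyOn S U

/-- The spectral radius `rᵢ(T) = inf {ν > 0 | Tⁿ / νⁿ → 0 in the sense of the class i}`, with
values in `[0, ∞]` and `inf ∅ = ∞`. -/
noncomputable def spectralRadius (i : OpClass) (T : X →ₗ[ℂ] X) : ℝ≥0∞ :=
  sInf {r : ℝ≥0∞ | ∃ ν : ℝ, 0 < ν ∧ TendsToZero i (fun n => ((ν : ℂ) ^ n)⁻¹ • T ^ n) ∧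
    r = ENNReal.ofReal ν}

end

/-- The geometrical radius `sup {|z| | z ∈ s}` of a set of complex numbers, with values in
`[0, ∞]` and `sup ∅ = 0`. -/
noncomputable def geometricRadius (s : Set ℂ) : ℝ≥0∞ :=
  ⨆ z ∈ s, ‖z‖ₑ

end TVSOperator

namespace TVSOperator

/-! Take |σ(K)| < μ < ν. The space of vectors with a backward orbit growing at most like μ^(-j) is
finite-dimensional (`finiteDimensional_boundedBackward`, by counting rather than convexity), and `K`
is bijective on it. If it were nonzero it would carry an eigenvalue of modulus at least μ
(`exists_eigenvector_of_boundedBackward_ne_bot`); eigenvalues lie in every spectrum, so the space is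
zero. Were the powers `K ^ n / μ ^ n` not uniformly bounded on `U` by a multiple of `U`, compactness
would produce a nonzero vector of that space (`exists_pow_bound`). Hence `K ^ n / ν ^ n` tends to
zero uniformly on `U`, the strongest of the four convergences (`TendsToZero.of_nb`). -/

open Filter Bornology

/-! ### Colourings of compact sets and of iterates -/

/-- A compact set is partitioned into finitely many pieces that are small of order `U`. -/
theorem exists_small_coloring {X : Type*} [AddCommGroup X]
    [TopologicalSpace X] [IsTopologicalAddGroup X] {C U : Set X} (hC : IsCompact C)
    (hU : U ∈ 𝓝 (0 : X)) :
    ∃ (N : ℕ) (χ : X → Fin N), ∀ x ∈ C, ∀ y ∈ C, χ x = χ y → x - y ∈ U := by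
  obtain ⟨W, hW, hWU⟩ := exists_nhds_half_neg hU
  obtain ⟨T, -, hT⟩ := hC.elim_nhds_subcover (fun x => (fun y => y - x) ⁻¹' W) fun x _ =>
    (continuous_id.sub continuous_const).continuousAt.preimage_mem_nhds (by simpa using hW)
  classical
  have hsel : ∀ x, ∃ i : Option T, x ∈ C → ∃ t : T, i = some t ∧ x - (t : X) ∈ W := by
    intro x
    by_cases hx : x ∈ C
    · obtain ⟨t, ht, hxt⟩ := Set.mem_iUnion₂.1 (hT hx)
      exact ⟨some ⟨t, ht⟩, fun _ => ⟨⟨t, ht⟩, rfl, hxt⟩⟩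
    · exact ⟨none, fun h => absurd h hx⟩
  choose f hf using hsel
  refine ⟨_, fun x => Fintype.equivFin (Option T) (f x), fun x hx y hy hxy => ?_⟩
  obtain ⟨s, hs, hxs⟩ := hf x hx
  obtain ⟨t, ht, hyt⟩ := hf y hy
  have hst : s = t := by
    have := (Fintype.equivFin (Option T)).injective hxy
    rw [hs, ht] at this
    exact Option.some.inj this
  subst hst
  simpa using hWU _ hxs _ hyt

/-- A family whose differences lie in `U` is partitioned by the `J`-th iterate of `K` into at most
`N ^ J` pieces whose differences lie in `t ^ J • U`. -/
theorem exists_coloring_iterate {X : Type*} [AddCommGroup X] [Module ℂ X]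
    {K : X →ₗ[ℂ] X} {U C : Set X} (hKU : ∀ x ∈ U, K x ∈ C) {t : ℂ} {N : ℕ} {χ : X → Fin N}
    (hχ : ∀ x ∈ C, ∀ y ∈ C, χ x = χ y → t⁻¹ • (x - y) ∈ U) {ι : Type*} {f : ι → X}
    (hf : ∀ a b, f a - f b ∈ U) (J : ℕ) :
    ∃ φ : ι → (Fin J → Fin N), ∀ a b, φ a = φ b →
      (t ^ J)⁻¹ • (K ^ J) (f a - f b) ∈ U := by
  induction J with
  | zero => exact ⟨fun _ => Fin.elim0, fun a b _ => by simpa using hf a b⟩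
  | succ J ih =>
    obtain ⟨φ, hφ⟩ := ih
    -- `ρ` picks one representative per colour class; the next colour is that of the image under `K`
    -- of the rescaled difference from it.
    set ρ : ι → ι := fun a => Set.rangeSplitting φ ⟨φ a, a, rfl⟩ with hρ
    have hφρ : ∀ a, φ (ρ a) = φ a := fun a => Set.apply_rangeSplitting φ ⟨φ a, a, rfl⟩
    set g : ι → X := fun a => K ((t ^ J)⁻¹ • (K ^ J) (f a - f (ρ a))) with hg
    have hgC : ∀ a, g a ∈ C := fun a => hKU _ (hφ _ _ (hφρ a).symm)
    refine ⟨fun a => Fin.cons (χ (g a)) (φ a), fun a b hab => ?_⟩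
    obtain ⟨h1, h2⟩ := Fin.cons_inj.1 hab
    have hr : ρ a = ρ b := by simp only [hρ, h2]
    have key := hχ _ (hgC a) _ (hgC b) h1
    convert key using 1
    simp only [hg, hr, pow_succ', Module.End.mul_apply, map_sub, map_smul, mul_inv, mul_smul,
      smul_sub]
    abel

/-! ### Bounded backward orbits -/

section

variable {X : Type*} [AddCommGroup X] [Module ℂ X] [TopologicalSpace X]

theorem eventually_smul_mem_of_isVonNBounded {D U : Set X} (hD : IsVonNBounded ℂ D)
    (hU : U ∈ 𝓝 (0 : X)) : ∀ᶠ c in 𝓝 (0 : ℂ), ∀ x ∈ D, c • x ∈ U :=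
  (absorbs_iff_eventually_nhds_zero (mem_of_mem_nhds hU)).1 (hD hU)

theorem isVonNBounded_const_smul [ContinuousSMul ℂ X] {D : Set X} (hD : IsVonNBounded ℂ D)
    (a : ℂ) : IsVonNBounded ℂ (a • D) := by
  have := hD.image (a • ContinuousLinearMap.id ℂ X)
  simpa [Set.image_smul] using this

/-- The vectors `y` that have a backward orbit `z` under `K` for which the sequence
`ν ^ j • z j` is bounded. -/
def boundedBackward [IsTopologicalAddGroup X] [ContinuousSMul ℂ X] (K : X →ₗ[ℂ] X) (ν : ℂ) :
    Submodule ℂ X where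
  carrier := {y | ∃ z : ℕ → X, z 0 = y ∧ (∀ j, K (z (j + 1)) = z j) ∧
    IsVonNBounded ℂ (Set.range fun j => ν ^ j • z j)}
  zero_mem' := ⟨fun _ => 0, rfl, fun _ => map_zero K, by
    simpa using Bornology.isVonNBounded_singleton (𝕜 := ℂ) (0 : X)⟩
  add_mem' := by
    rintro _ _ ⟨z, rfl, hz, hzb⟩ ⟨w, rfl, hw, hwb⟩
    refine ⟨fun j => z j + w j, rfl, fun j => by simp [hz, hw], (hzb.add hwb).subset ?_⟩
    rintro _ ⟨j, rfl⟩
    simp only [smul_add]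
    exact Set.add_mem_add ⟨j, rfl⟩ ⟨j, rfl⟩
  smul_mem' := by
    rintro a _ ⟨z, rfl, hz, hzb⟩
    refine ⟨fun j => a • z j, rfl, fun j => by simp [hz],
      (isVonNBounded_const_smul hzb a).subset ?_⟩
    rintro _ ⟨j, rfl⟩
    exact ⟨_, ⟨j, rfl⟩, smul_comm _ _ _⟩

/-- One bounded set serves all `j` and all coefficients: balanced hulls and finite sums preserve
boundedness even without local convexity. -/
theorem exists_isVonNBounded_sum [IsTopologicalAddGroup X] [ContinuousSMul ℂ X] {ι : Type*}
    (s : Finset ι) (w : ι → ℕ → X) (hw : ∀ i, IsVonNBounded ℂ (Set.range (w i))) :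
    ∃ D : Set X, IsVonNBounded ℂ D ∧ ∀ a : ι → ℂ, (∀ i, ‖a i‖ ≤ 1) → ∀ j,
      ∑ i ∈ s, a i • w i j ∈ D := by
  classical
  induction s using Finset.induction_on with
  | empty => exact ⟨{0}, Bornology.isVonNBounded_singleton 0, by simp⟩
  | insert i s hi ih =>
    obtain ⟨D, hD, hsum⟩ := ih
    have hb : IsVonNBounded ℂ (balancedHull ℂ (Set.range (w i))) := by
      refine (nhds_basis_balanced ℂ X).isVonNBounded_iff.2 fun V hV => ?_
      filter_upwards [hw i hV.1] with c hc
      exact (hV.2.smul c).balancedHull_subset_of_subset hc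
    refine ⟨_, hb.add hD, fun a ha j => ?_⟩
    rw [Finset.sum_insert hi]
    exact Set.add_mem_add (mem_balancedHull_iff.2 ⟨a i, ha i, _, ⟨j, rfl⟩, rfl⟩) (hsum a ha j)

/-- Given `d` independent vectors with `N < 2 ^ d`, the `2 ^ (d * J)` grid combinations of their
orbits at time `J + 1` outnumber the `N ^ J` colours. Two of them collide, giving small combinations
of the `e i` with nonzero integer coefficients, impossible as `J` grows. -/
theorem finiteDimensional_boundedBackward [IsTopologicalAddGroup X] [ContinuousSMul ℂ X]
    [T2Space X] {K : X →ₗ[ℂ] X} {U C : Set X} (hU : U ∈ 𝓝 (0 : X)) (hC : IsCompact C)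
    (hKU : ∀ x ∈ U, K x ∈ C) {ν : ℂ} (hν : ν ≠ 0) :
    FiniteDimensional ℂ (boundedBackward K ν) := by
  -- The gain `4 ^ J` beats the mesh `2 ^ (-J)` of the grid and leaves a factor `2 ^ J`.
  set t : ℂ := ν / 4 with ht
  have ht0 : t ≠ 0 := div_ne_zero hν (by norm_num)
  obtain ⟨N, χ, hχ⟩ := exists_small_coloring hC
    ((set_smul_mem_nhds_zero_iff ht0).2 hU)
  replace hχ : ∀ x ∈ C, ∀ y ∈ C, χ x = χ y → t⁻¹ • (x - y) ∈ U := fun x hx y hy h =>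
    (Set.mem_smul_set_iff_inv_smul_mem₀ ht0 _ _).1 (hχ x hx y hy h)
  obtain ⟨d, hd⟩ : ∃ d : ℕ, N < 2 ^ d := ⟨N, Nat.lt_two_pow_self⟩
  by_contra hfin
  have hrank : (d : Cardinal) ≤ Module.rank ℂ (boundedBackward K ν) := by
    refine (Cardinal.natCast_lt_aleph0 (n := d)).le.trans ?_
    by_contra h
    exact hfin (Module.rank_lt_aleph0_iff.1 (not_le.1 h))
  obtain ⟨e', he'⟩ := exists_linearIndependent_of_le_rank hrank
  set e : Fin d → X := fun i => (e' i : X) with he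
  have hli : LinearIndependent ℂ e :=
    he'.map' (boundedBackward K ν).subtype (Submodule.ker_subtype _)
  choose z hz0 hz hzb using fun i => (e' i).2
  obtain ⟨D, hD, hsum⟩ := exists_isVonNBounded_sum Finset.univ
    (fun (i : Fin d) j => ν ^ j • z i j) hzb
  obtain ⟨m, hm, hm0⟩ : ∃ m : ℂ, (∀ x ∈ D, m • x ∈ U) ∧ m ≠ 0 :=
    (((eventually_smul_mem_of_isVonNBounded hD hU).filter_mono nhdsWithin_le_nhds).and
      (eventually_mem_nhdsWithin (a := (0 : ℂ)) (s := {0}ᶜ))).exists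
  have hKz : ∀ (i : Fin d) (J l : ℕ), (K ^ J) (z i (l + J)) = z i l := by
    intro i J
    induction J with
    | zero => simp
    | succ J ih =>
      intro l
      rw [pow_succ, Module.End.mul_apply, ← add_assoc, hz, ih]
  have key : ∀ J : ℕ, 0 < J → ∃ a : Fin d → ℂ, 1 ≤ ‖a‖ ∧
      ((m⁻¹ * ν⁻¹) * (1 / 2) ^ J)⁻¹ • ∑ i, a i • e i ∈ C := by
    intro J hJ
    set f : (Fin d → Fin (2 ^ J)) → X := fun k =>
      m • ∑ i, ((k i : ℂ) / 2 ^ J) • ν ^ (J + 1) • z i (J + 1) with hf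
    have hfsub : ∀ k k', f k - f k' =
        m • ∑ i, (((k i : ℂ) - (k' i : ℂ)) / 2 ^ J) • ν ^ (J + 1) • z i (J + 1) := by
      intro k k'
      simp only [hf, ← smul_sub, ← Finset.sum_sub_distrib, ← sub_smul, ← sub_div]
    have hfU : ∀ k k', f k - f k' ∈ U := by
      intro k k'
      rw [hfsub]
      refine hm _ (hsum (fun i => ((k i : ℂ) - (k' i : ℂ)) / 2 ^ J) (fun i => ?_) (J + 1))
      rw [norm_div, norm_pow, Complex.norm_ofNat, div_le_one (by positivity)]
      have hcast : ((k i : ℂ) - (k' i : ℂ)) = (((k i : ℝ) - (k' i : ℝ) : ℝ) : ℂ) := by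
        push_cast; rfl
      rw [hcast, Complex.norm_real, Real.norm_eq_abs, abs_le]
      have h1 : ((k i : ℕ) : ℝ) ≤ 2 ^ J := by exact_mod_cast (k i).2.le
      have h2 : ((k' i : ℕ) : ℝ) ≤ 2 ^ J := by exact_mod_cast (k' i).2.le
      have h3 : (0 : ℝ) ≤ (k i : ℕ) := Nat.cast_nonneg _
      have h4 : (0 : ℝ) ≤ (k' i : ℕ) := Nat.cast_nonneg _
      constructor <;> linarith
    obtain ⟨φ, hφ⟩ := exists_coloring_iterate hKU hχ hfU J
    obtain ⟨k, k', hne, hkk'⟩ : ∃ k k', k ≠ k' ∧ φ k = φ k' := by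
      refine Fintype.exists_ne_map_eq_of_card_lt φ ?_
      simp only [Fintype.card_pi, Fintype.card_fin, Finset.prod_const, Finset.card_univ]
      rw [← pow_mul, mul_comm, pow_mul]
      exact Nat.pow_lt_pow_left hd hJ.ne'
    refine ⟨fun i => (k i : ℂ) - (k' i : ℂ), ?_, ?_⟩
    · obtain ⟨i, hi⟩ := Function.ne_iff.1 hne
      refine le_trans ?_ (norm_le_pi_norm _ i)
      have hcast : ((k i : ℂ) - (k' i : ℂ)) = (((k i : ℤ) - (k' i : ℤ) : ℤ) : ℂ) := by
        push_cast; rfl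
      simp only [hcast, Complex.norm_intCast]
      have : ((k i : ℕ) : ℤ) - ((k' i : ℕ) : ℤ) ≠ 0 := fun h => hi (Fin.ext (by omega))
      exact_mod_cast Int.one_le_abs this
    · have h1 := hKU _ (hφ k k' hkk')
      convert h1 using 1
      rw [hfsub]
      have hKz1 : ∀ i, (K ^ J) (z i (J + 1)) = z i 1 := fun i => by
        rw [add_comm]; exact hKz i J 1
      have hKe : ∀ i, K (z i 1) = e i := fun i => (hz i 0).trans (hz0 i)
      simp only [map_smul, map_sum, hKz1, hKe, Finset.smul_sum, smul_smul]
      refine Finset.sum_congr rfl fun i _ => ?_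
      congr 1
      have h4 : (4 : ℂ) ^ J = 2 ^ J * 2 ^ J := by rw [← mul_pow]; norm_num
      rw [ht, div_pow, div_pow, h4, one_pow, pow_succ]
      field_simp
  choose a ha haC using fun J : ℕ => key (J + 1) J.succ_pos
  set L : (Fin d → ℂ) →ₗ[ℂ] X := Fintype.linearCombination ℂ e with hL
  have hLc : Topology.IsClosedEmbedding L :=
    LinearMap.isClosedEmbedding_of_injective (LinearMap.ker_eq_bot.2
      (linearIndependent_iff_injective_fintypeLinearCombination.1 hli))
  have hε : Tendsto (fun J : ℕ => (m⁻¹ * ν⁻¹) * (1 / 2 : ℂ) ^ (J + 1)) atTop (𝓝 0) := by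
    simpa using ((tendsto_pow_atTop_nhds_zero_of_norm_lt_one
      (x := (1 / 2 : ℂ)) (by norm_num)).comp (tendsto_add_atTop_nat 1)).const_mul (m⁻¹ * ν⁻¹)
  have hlim := (hC.isVonNBounded ℂ).smul_tendsto_zero (Eventually.of_forall haC) hε
  have hlim' : Tendsto (L ∘ a) atTop (𝓝 (L 0)) := by
    rw [map_zero]
    refine hlim.congr fun J => ?_
    have h0 : (m⁻¹ * ν⁻¹) * (1 / 2 : ℂ) ^ (J + 1) ≠ 0 :=
      mul_ne_zero (mul_ne_zero (inv_ne_zero hm0) (inv_ne_zero hν)) (by norm_num)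
    simp only [Pi.smul_apply', Function.comp_apply, hL, Fintype.linearCombination_apply]
    rw [smul_inv_smul₀ h0]
  have ha0 := (hLc.isInducing.tendsto_nhds_iff.2 hlim').norm
  rw [norm_zero] at ha0
  exact absurd (ge_of_tendsto' ha0 ha) (by norm_num)

/-- Injectivity on the space forces the backward orbit of an eigenvector to be `l ^ (-j) • y`; its
boundedness after scaling by `ν ^ j` forces `‖ν‖ ≤ ‖l‖`. -/
theorem exists_eigenvector_of_boundedBackward_ne_bot [IsTopologicalAddGroup X]
    [ContinuousSMul ℂ X] [T2Space X] {K : X →ₗ[ℂ] X} {ν : ℂ} (hν : ν ≠ 0)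
    [FiniteDimensional ℂ (boundedBackward K ν)] (hne : boundedBackward K ν ≠ ⊥) :
    ∃ (l : ℂ) (y : X), y ≠ 0 ∧ K y = l • y ∧ ‖ν‖ ≤ ‖l‖ := by
  have hshift : ∀ y ∈ boundedBackward K ν, ∃ x ∈ boundedBackward K ν, K x = y := by
    rintro _ ⟨z, rfl, hz, hzb⟩
    refine ⟨z 1, ⟨fun j => z (j + 1), rfl, fun j => hz _, ?_⟩, hz 0⟩
    refine (isVonNBounded_const_smul hzb ν⁻¹).subset ?_
    rintro _ ⟨j, rfl⟩
    refine ⟨_, ⟨j + 1, rfl⟩, ?_⟩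
    simp only [pow_succ', mul_smul]
    rw [inv_smul_smul₀ hν]
  have hmap : ∀ y ∈ boundedBackward K ν, K y ∈ boundedBackward K ν := by
    rintro _ ⟨z, rfl, hz, hzb⟩
    refine ⟨fun j => Nat.casesOn j (K (z 0)) z, rfl, fun j => by cases j <;> simp [hz], ?_⟩
    refine (((isVonNBounded_const_smul hzb ν)).union
      (Bornology.isVonNBounded_singleton (K (z 0)))).subset ?_
    rintro _ ⟨j, rfl⟩
    cases j with
    | zero => right; simp
    | succ j =>
      left
      refine ⟨_, ⟨j, rfl⟩, ?_⟩
      simp only [pow_succ', mul_smul]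
  set T : Module.End ℂ (boundedBackward K ν) := K.restrict hmap with hT
  have hsurj : Function.Surjective T := by
    rintro ⟨y, hy⟩
    obtain ⟨x, hx, hxy⟩ := hshift y hy
    exact ⟨⟨x, hx⟩, Subtype.ext hxy⟩
  have hinj : Function.Injective T := LinearMap.injective_iff_surjective.2 hsurj
  have : Nontrivial (boundedBackward K ν) := Submodule.nontrivial_iff_ne_bot.2 hne
  obtain ⟨l, hl⟩ := Module.End.exists_eigenvalue T
  obtain ⟨y, hy⟩ := hl.exists_hasEigenvector
  have hTy : T y = l • y := hy.apply_eq_smul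
  have hKy : K (y : X) = l • (y : X) := congrArg Subtype.val hTy
  have hy0 : (y : X) ≠ 0 := fun h => hy.2 (Subtype.ext h)
  have hl0 : l ≠ 0 := by
    rintro rfl
    exact hy.2 (hinj (by rw [hTy, zero_smul, map_zero]))
  refine ⟨l, y, hy0, hKy, ?_⟩
  by_contra hlt
  rw [not_le] at hlt
  obtain ⟨z, hz0, hz, hzb⟩ := y.2
  have hzmem : ∀ j, z j ∈ boundedBackward K ν := by
    intro j
    refine ⟨fun i => z (i + j), by simp, fun i => ?_, ?_⟩
    · simpa only [add_right_comm] using hz (i + j)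
    refine (isVonNBounded_const_smul hzb (ν ^ j)⁻¹).subset ?_
    rintro _ ⟨i, rfl⟩
    refine ⟨_, ⟨i + j, rfl⟩, ?_⟩
    simp only [pow_add, smul_smul]
    congr 1
    field_simp
  have hzj : ∀ j, l ^ j • z j = y := by
    intro j
    induction j with
    | zero => simpa using hz0
    | succ j ih =>
      have h1 : T ⟨z (j + 1), hzmem _⟩ = T (l⁻¹ • ⟨z j, hzmem _⟩) := by
        have h2 : T ⟨z (j + 1), hzmem _⟩ = ⟨z j, hzmem _⟩ := Subtype.ext (hz j)
        have h3 : (⟨z j, hzmem j⟩ : boundedBackward K ν) = (l ^ j)⁻¹ • y := by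
          refine Subtype.ext ?_
          simp only [Submodule.coe_smul]
          rw [← ih, inv_smul_smul₀ (pow_ne_zero _ hl0)]
        rw [h2, map_smul, h3, map_smul, hTy, smul_smul, smul_smul]
        congr 1
        field_simp
      have h4 : z (j + 1) = l⁻¹ • z j := congrArg Subtype.val (hinj h1)
      rw [h4, smul_smul, ← ih, pow_succ, mul_assoc, mul_inv_cancel₀ hl0, mul_one]
  have hq : Tendsto (fun j : ℕ => (l / ν) ^ j) atTop (𝓝 0) :=
    tendsto_pow_atTop_nhds_zero_of_norm_lt_one (by
      rw [norm_div, div_lt_one (norm_pos_iff.2 hν)]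
      exact hlt)
  have hlim := hzb.smul_tendsto_zero
    (x := fun j => ν ^ j • z j) (Eventually.of_forall fun j => ⟨j, rfl⟩) hq
  refine hy0 (tendsto_nhds_unique (tendsto_const_nhds.congr fun j => ?_) hlim)
  rw [Pi.smul_apply', smul_smul, ← hzj j]
  congr 1
  rw [← mul_pow, div_mul_cancel₀ _ hν]

/-! ### Uniform bounds for the powers -/

theorem exists_pow_bound [IsTopologicalAddGroup X] [ContinuousSMul ℂ X] [T2Space X]
    {K : X →ₗ[ℂ] X} (hK : Continuous K) {U C : Set X} (hU : U ∈ 𝓝 (0 : X))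
    (hUb : Balanced ℂ U) (hC : IsCompact C) (hKU : ∀ x ∈ U, K x ∈ C) {ν : ℂ} (hν : ν ≠ 0)
    (hbot : boundedBackward K ν = ⊥) :
    ∃ M : ℕ, ∀ n, ∀ x ∈ U, (((M : ℂ) + 1) * ν ^ n)⁻¹ • (K ^ n) x ∈ U := by
  by_contra! hcon
  classical
  -- The first exponent violating the bound `M + 1`; all earlier iterates stay controlled.
  set n : ℕ → ℕ := fun M => Nat.find (hcon M) with hn
  choose x hxU hx using fun M => Nat.find_spec (hcon M)
  have hmin : ∀ M k, k < n M → ∀ y ∈ U, (((M : ℂ) + 1) * ν ^ k)⁻¹ • (K ^ k) y ∈ U := by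
    intro M k hk
    simpa using Nat.find_min (hcon M) hk
  have hM0 : ∀ M : ℕ, (M : ℂ) + 1 ≠ 0 := fun M => by exact_mod_cast M.succ_ne_zero
  have hinv : Tendsto (fun M : ℕ => ((M : ℂ) + 1)⁻¹) atTop (𝓝 0) := by
    simpa using tendsto_one_div_add_atTop_nhds_zero_nat (𝕜 := ℂ)
  have hsmall : ∀ k, ∀ᶠ M : ℕ in atTop,
      ∀ y ∈ U, (((M : ℂ) + 1) * ν ^ k)⁻¹ • (K ^ k) y ∈ U := by
    intro k
    cases k with
    | zero =>
      filter_upwards with M y hy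
      refine hUb.smul_mem ?_ (by simpa using hy)
      rw [pow_zero, mul_one, norm_inv]
      have : ‖(M : ℂ) + 1‖ = M + 1 := by
        rw [← Nat.cast_succ, Complex.norm_natCast]
        simp
      rw [this]
      exact inv_le_one_of_one_le₀ (by simp)
    | succ k =>
      have hcont : Continuous (K ^ k) := by
        induction k with
        | zero => exact continuous_id
        | succ k ih => rw [pow_succ]; exact ih.comp hK
      have hb := (hC.image hcont).isVonNBounded ℂ
      have hlim : Tendsto (fun M : ℕ => (((M : ℂ) + 1) * ν ^ (k + 1))⁻¹) atTop (𝓝 0) := by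
        simpa [mul_inv, mul_comm] using hinv.mul_const (ν ^ (k + 1))⁻¹
      filter_upwards [hlim.eventually (eventually_smul_mem_of_isVonNBounded hb hU)] with M hM y hy
      exact hM _ ⟨K y, hKU y hy, by rw [pow_succ, Module.End.mul_apply]⟩
  have hnlt : ∀ j, ∀ᶠ M in atTop, j < n M := by
    intro j
    filter_upwards [(Set.finite_Iic j).eventually_all.2 fun k _ => hsmall k] with M hM
    by_contra h
    exact hx M (hM _ (not_lt.1 h) _ (hxU M))
  -- The orbit of `x M` read backwards, scaled so that `z M 0` is outside `U`; only `j ≤ n M`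
  -- matters, and `n M` tends to infinity.
  set z : ℕ → ℕ → X := fun M j => (((M : ℂ) + 1) * ν ^ n M)⁻¹ • (K ^ (n M - j)) (x M) with hz
  have hzU : ∀ M j, j < n M → ν ^ (j + 1) • z M (j + 1) ∈ U := by
    intro M j hj
    have h1 := hmin M (n M - (j + 1)) (by omega) _ (hxU M)
    convert h1 using 1
    simp only [hz, smul_smul]
    congr 1
    have h2 : ν ^ n M = ν ^ (n M - (j + 1)) * ν ^ (j + 1) := by rw [← pow_add]; congr 1; omega
    rw [h2]
    have := hM0 M
    field_simp
  have hKz : ∀ M j, j < n M → K (z M (j + 1)) = z M j := by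
    intro M j hj
    simp only [hz, map_smul]
    rw [← Module.End.mul_apply, ← pow_succ']
    congr 3
    omega
  -- An ultrafilter gives limits for all `j` at once, without sequential compactness of `C`.
  set l : Ultrafilter ℕ := hyperfilter ℕ with hl
  have hle : (l : Filter ℕ) ≤ atTop := by
    rw [← Nat.cofinite_eq_atTop]
    exact hyperfilter_le_cofinite
  have hexlim : ∀ j, ∃ c ∈ C, Tendsto (fun M => ν ^ (j + 1) • z M j) l (𝓝 c) := by
    intro j
    refine hC.ultrafilter_le_nhds' (l.map fun M => ν ^ (j + 1) • z M j) ?_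
    rw [Ultrafilter.mem_map]
    filter_upwards [hle (hnlt j)] with M hM
    rw [Set.mem_preimage, ← hKz M j hM, ← map_smul]
    exact hKU _ (hzU M j hM)
  choose c hcC hc using hexlim
  set w : ℕ → X := fun j => (ν ^ (j + 1))⁻¹ • c j with hw
  have hzw : ∀ j, Tendsto (fun M => z M j) l (𝓝 (w j)) := by
    intro j
    refine ((hc j).const_smul (ν ^ (j + 1))⁻¹).congr fun M => ?_
    rw [inv_smul_smul₀ (pow_ne_zero _ hν)]
  have hKw : ∀ j, K (w (j + 1)) = w j := by
    intro j
    refine tendsto_nhds_unique (((hK.tendsto _).comp (hzw (j + 1))).congr' ?_) (hzw j)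
    filter_upwards [hle (hnlt j)] with M hM
    exact hKz M j hM
  have hw0 : w 0 ∈ boundedBackward K ν := by
    refine ⟨w, rfl, hKw, (isVonNBounded_const_smul (hC.isVonNBounded ℂ) ν⁻¹).subset ?_⟩
    rintro _ ⟨j, rfl⟩
    refine ⟨c j, hcC j, ?_⟩
    simp only [hw, smul_smul]
    congr 1
    rw [pow_succ]
    field_simp
  rw [hbot, Submodule.mem_bot] at hw0
  have h0 := hzw 0
  rw [hw0] at h0
  obtain ⟨M, hM⟩ := (h0.eventually hU).exists
  exact hx M hM

/-! ### Comparison of convergences and conclusion -/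

theorem TendsToZero.of_nb [IsTopologicalAddGroup X] [ContinuousSMul ℂ X] {S : ℕ → X →ₗ[ℂ] X}
    (h : TendsToZero .nb S) (i : OpClass) : TendsToZero i S := by
  obtain ⟨U, hU, hSU⟩ := h
  cases i with
  | nb => exact ⟨U, hU, hSU⟩
  | c =>
    intro V hV
    refine ⟨U, hU, fun ε hε => hSU _ ?_⟩
    exact (set_smul_mem_nhds_zero_iff (by exact_mod_cast hε.ne')).2 hV
  | bb =>
    intro A hA V hV
    obtain ⟨a, ha, ha0⟩ : ∃ a : ℂ, (∀ x ∈ A, a • x ∈ U) ∧ a ≠ 0 :=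
      (((eventually_smul_mem_of_isVonNBounded hA hU).filter_mono nhdsWithin_le_nhds).and
        (eventually_mem_nhdsWithin (a := (0 : ℂ)) (s := {0}ᶜ))).exists
    obtain ⟨n₀, hn₀⟩ := hSU (a • V) ((set_smul_mem_nhds_zero_iff ha0).2 hV)
    refine ⟨n₀, fun n hn => ?_⟩
    rintro _ ⟨x, hx, rfl⟩
    have h1 := hn₀ n hn ⟨a • x, ha x hx, rfl⟩
    rw [map_smul] at h1
    exact (Set.smul_mem_smul_set_iff₀ ha0 _ _).1 h1
  | nn =>
    -- Base members must lie in a multiple of `U`, where the convergence is uniform.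
    refine ⟨{W | W ∈ 𝓝 (0 : X) ∧ Balanced ℂ W ∧ ∃ a : ℂ, a ≠ 0 ∧ W ⊆ a • U}, ?_, ?_⟩
    · have hmono : ∀ {W W' : Set X}, (∃ a : ℂ, a ≠ 0 ∧ W ⊆ a • U) → W' ⊆ W →
          ∃ a : ℂ, a ≠ 0 ∧ W' ⊆ a • U := fun ⟨a, ha, h⟩ h' => ⟨a, ha, h'.trans h⟩
      have hcore : ∀ W ∈ 𝓝 (0 : X), balancedCore ℂ (W ∩ U) ∈
          {W | W ∈ 𝓝 (0 : X) ∧ Balanced ℂ W ∧ ∃ a : ℂ, a ≠ 0 ∧ W ⊆ a • U} := fun W hW =>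
        ⟨balancedCore_mem_nhds_zero (Filter.inter_mem hW hU), balancedCore_balanced _, 1,
          one_ne_zero, by
            rw [one_smul]
            exact (balancedCore_subset _).trans Set.inter_subset_right⟩
      have hsub : ∀ W : Set X, balancedCore ℂ (W ∩ U) ⊆ W := fun W =>
        (balancedCore_subset _).trans Set.inter_subset_left
      refine ⟨fun V hV => hV.1, fun W hW => ⟨_, hcore W hW, hsub W⟩, fun V hV => hV.2.1,
        fun V₁ h₁ V₂ h₂ => ⟨_, hcore _ (Filter.inter_mem h₁.1 h₂.1), hsub _⟩,
        fun V hV => ?_, fun V hV a ha => ?_⟩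
      · obtain ⟨W, hW, hWV⟩ := exists_nhds_zero_half hV.1
        refine ⟨_, hcore W hW, ?_⟩
        rintro _ ⟨x, hx, y, hy, rfl⟩
        exact hWV _ (hsub W hx) _ (hsub W hy)
      · obtain ⟨hV0, hVb, b, hb, hVU⟩ := hV
        refine ⟨(set_smul_mem_nhds_zero_iff ha).2 hV0, hVb.smul a, a * b, mul_ne_zero ha hb, ?_⟩
        rw [mul_smul]
        exact Set.smul_set_mono hVU
    · rintro W ⟨hW, -, a, ha, hWU⟩ ε hε
      have hε0 : (ε : ℂ) ≠ 0 := by exact_mod_cast hε.ne'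
      obtain ⟨n₀, hn₀⟩ := hSU (a⁻¹ • (ε : ℂ) • W)
        ((set_smul_mem_nhds_zero_iff (inv_ne_zero ha)).2
          ((set_smul_mem_nhds_zero_iff hε0).2 hW))
      refine ⟨n₀, fun n hn => ?_⟩
      rintro _ ⟨x, hx, rfl⟩
      obtain ⟨u, hu, rfl⟩ := hWU hx
      have h1 := hn₀ n hn ⟨u, hu, rfl⟩
      rw [Set.mem_smul_set_iff_inv_smul_mem₀ (inv_ne_zero ha), inv_inv] at h1
      simpa using h1

theorem mem_spectrum_of_eigenvector {K : X →ₗ[ℂ] X} {l : ℂ} {y : X} (hy : y ≠ 0)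
    (hKy : K y = l • y) (j : OpClass) : l ∈ spectrum j K := by
  rintro ⟨R, hR, -, -⟩
  have h := LinearMap.congr_fun hR y
  simp [hKy] at h
  exact hy h.symm

theorem tendsToZero_nb_of_pow_bound [ContinuousSMul ℂ X]
    {K : X →ₗ[ℂ] X} {U C : Set X} (hU : U ∈ 𝓝 (0 : X)) (hC : IsVonNBounded ℂ C)
    (hKU : ∀ x ∈ U, K x ∈ C) {μ ν b : ℂ} (hμ : μ ≠ 0) (hb : b ≠ 0) (hμν : ‖μ‖ < ‖ν‖)
    (hbound : ∀ n, ∀ x ∈ U, (b * μ ^ n)⁻¹ • (K ^ n) x ∈ U) :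
    TendsToZero .nb (fun n => (ν ^ n)⁻¹ • K ^ n) := by
  have hν : ν ≠ 0 := norm_pos_iff.1 ((norm_nonneg μ).trans_lt hμν)
  refine ⟨U, hU, fun V hV => ?_⟩
  have hlim : Tendsto (fun n : ℕ => (b / ν) * (μ / ν) ^ n) atTop (𝓝 0) := by
    simpa using (tendsto_pow_atTop_nhds_zero_of_norm_lt_one (x := μ / ν) (by
      rwa [norm_div, div_lt_one (norm_pos_iff.2 hν)])).const_mul (b / ν)
  obtain ⟨n₀, hn₀⟩ := eventually_atTop.1
    (hlim.eventually (eventually_smul_mem_of_isVonNBounded hC hV))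
  refine ⟨n₀, fun n hn => ?_⟩
  rintro _ ⟨x, hx, rfl⟩
  -- One factor `K` is kept in reserve to move `U` into the bounded set `C`.
  obtain ⟨k, rfl⟩ : ∃ k, n = k + 1 := ⟨n - 1, by omega⟩
  have h1 := hn₀ k (by omega) _ (hKU _ (hbound k x hx))
  convert h1 using 1
  rw [LinearMap.smul_apply, pow_succ' K, Module.End.mul_apply, map_smul, smul_smul]
  congr 1
  rw [div_pow, pow_succ]
  field_simp

end

end TVSOperator

theorem mainTheorem2 {X : Type*} [AddCommGroup X] [Module ℂ X] [TopologicalSpace X]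
    [IsTopologicalAddGroup X] [ContinuousSMul ℂ X] [T2Space X]
    (K : X →ₗ[ℂ] X) (hK : IsCompactOperator K) (i j : TVSOperator.OpClass) :
    TVSOperator.spectralRadius i K ≤
      TVSOperator.geometricRadius (TVSOperator.spectrum j K) := by
  obtain ⟨C, hC, hKC⟩ := hK
  set U := balancedCore ℂ (K ⁻¹' C) with hUdef
  have hU : U ∈ 𝓝 (0 : X) := balancedCore_mem_nhds_zero hKC
  have hKU : ∀ x ∈ U, K x ∈ C := fun x hx => balancedCore_subset (K ⁻¹' C) hx
  refine le_of_forall_gt_imp_ge_of_dense fun r hr => ?_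
  obtain ⟨ν, hgν, hνr⟩ := ENNReal.lt_iff_exists_nnreal_btwn.1 hr
  -- The gap between `μ` and `ν` turns boundedness of the powers into decay.
  obtain ⟨μ, hgμ, hμν⟩ := ENNReal.lt_iff_exists_nnreal_btwn.1 hgν
  have hμ0 : 0 < μ := by exact_mod_cast zero_le.trans_lt hgμ
  have hμν' : (μ : ℝ) < ν := by exact_mod_cast hμν
  have hμC : ((μ : ℝ) : ℂ) ≠ 0 := by exact_mod_cast hμ0.ne'
  have hfin := TVSOperator.finiteDimensional_boundedBackward hU hC hKU hμC
  have hbot : TVSOperator.boundedBackward K ((μ : ℝ) : ℂ) = ⊥ := by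
    by_contra hne
    obtain ⟨l, y, hy, hKy, hl⟩ := TVSOperator.exists_eigenvector_of_boundedBackward_ne_bot hμC hne
    refine absurd hgμ (not_lt.2 ?_)
    refine le_trans ?_ (le_iSup₂ (f := fun (z : ℂ) (_ : z ∈ TVSOperator.spectrum j K) => ‖z‖ₑ) l
      (TVSOperator.mem_spectrum_of_eigenvector hy hKy j))
    rw [enorm_eq_nnnorm]
    have : (μ : ℝ) ≤ ‖l‖ := by simpa using hl
    exact_mod_cast this
  obtain ⟨M, hM⟩ := TVSOperator.exists_pow_bound (IsCompactOperator.continuous ⟨C, hC, hKC⟩) hU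
    (balancedCore_balanced _) hC hKU hμC hbot
  have hnb := TVSOperator.tendsToZero_nb_of_pow_bound (ν := ((ν : ℝ) : ℂ)) hU (hC.isVonNBounded ℂ) hKU hμC
    (by exact_mod_cast M.succ_ne_zero) (by simpa using hμν') hM
  refine le_trans (sInf_le ⟨ν, μ.coe_nonneg.trans_lt hμν', hnb.of_nb i, rfl⟩) ?_
  rw [ENNReal.ofReal_coe_nnreal]
  exact hνr.le
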